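/- Let $k$ be an algebraically closed field of characteristic $0$, let $C$ be a curve over $k$ (an integral separated $k$-scheme of finite type and of dimension $1$) with function field $F=k(C)$, and let $f(z)\in F[z]$ and $P\in F$. Write $f^N$ for the $N$-th iterate of $f$. A place $v$ of $F$ is a discrete valuation ring of $F$ containing $k$; the polynomial $f$ has good reduction at $v$ if all coefficients $a_i$ of $f$ satisfy $|a_i|_v\le 1$ and its leading coefficient satisfies $|a_d|_v=1$ (for monic $f$: all $|a_i|_v\leq 1$); the $v$-adic filled Julia set of $f$ is the set of elements whose forward orbit under $f$ is $v$-adically bounded. Suppose that there is a place $v$ of $F$ at which $f$ has good reduction and such that $P$ is not in the $v$-adic filled Julia set of $f$. Let $U\subseteq C$ be any nonempty open set on which $P$ and all coefficients of $f$ are regular (for instance the largest one), and for each $N\ge 0$ let $X^{\mathrm{Pre}}_{f,P}(N)$, the $N$-th preimage curve, be a smooth projective model of the (reduced) curve \[\{(z,t) : f_t^N(z)=P_t\}\subseteq \mathbb{A}^1\times U,\] that is, a smooth projective (equivalently, smooth proper) $k$-scheme having a dense open subscheme which is isomorphic over $k$ to a dense open subscheme of that curve. Then the number of irreducible components of $X^{\mathrm{Pre}}_{f,P}(N)$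 is finite and does not depend on $N$ once $N$ is sufficiently large. -/

import Mathlib

universe u

open AlgebraicGeometry CategoryTheory Polynomial

noncomputable section

namespace PreimageCurve

/-! ### Dynamics of a polynomial over a field with a valuation ring -/

section Dynamics

variable {F : Type u} [Field F]

/-- A polynomial has good reduction at a valuation ring if its coefficients are integral and its
leading coefficient is a unit, i.e. if it reduces to a polynomial of the same degree over the
residue field. For a monic polynomial this says that all coefficients have absolute value at
most `1`. -/
def HasGoodReduction (V : ValuationSubring F) (f : F[X]) : Prop :=
  (∀ i, f.coeff i ∈ V) ∧ V.valuation f.leadingCoeff = 1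

/-- The (`F`-rational points of the) filled Julia set of `f`: the points whose forward orbit
under `f` is bounded for the (multiplicatively written) valuation. -/
def filledJuliaSet (V : ValuationSubring F) (f : F[X]) : Set F :=
  {x | ∃ M : V.ValueGroup, ∀ n : ℕ, V.valuation ((fun y => f.eval y)^[n] x) ≤ M}

end Dynamics

/-! ### Curves and places -/

section Curves

variable {k : Type u} [Field k]

/-- A curve over `k`: an integral separated scheme of finite type over `k`, of dimension `1`. -/
structure IsCurve {C : Scheme.{u}} [IsIntegral C] (π : C ⟶ Spec (.of k)) : Prop where
  isSeparated : IsSeparated π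
  locallyOfFiniteType : LocallyOfFiniteType π
  quasiCompact : QuasiCompact π
  dim_eq_one : topologicalKrullDim C = 1

/-- The inclusion of the field of constants `k` into the function field of a `k`-scheme. -/
def constants {C : Scheme.{u}} [IsIntegral C] (π : C ⟶ Spec (.of k)) : k →+* C.functionField :=
  haveI : Nonempty (⊤ : C.Opens) := ⟨⟨genericPoint C, trivial⟩⟩
  (C.germToFunctionField ⊤).hom.comp (π.appTop.hom.comp (Scheme.ΓSpecIso (.of k)).inv.hom)

/-- A place of the function field `k(C)`: a discrete valuation ring of `k(C)` which contains `k`. -/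
structure IsPlace {C : Scheme.{u}} [IsIntegral C] (π : C ⟶ Spec (.of k))
    (V : ValuationSubring C.functionField) : Prop where
  isDiscreteValuationRing : IsDiscreteValuationRing V
  constants_mem : ∀ a : k, constants π a ∈ V

/-- `Y` is a smooth projective model of the `k`-scheme `Z` (a curve, possibly reducible): it is
smooth and proper over `k`, and a dense open subscheme of `Y` is isomorphic over `k` to a dense
open subscheme of `Z`. (Such a `Y` is one-dimensional, and proper curves are projective.) -/
structure IsSmoothProjectiveModel {Y Z : Scheme.{u}} (σ : Y ⟶ Spec (.of k))
    (ζ : Z ⟶ Spec (.of k)) : Prop where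
  smooth : Smooth σ
  proper : IsProper σ
  birational : Scheme.BirationalOver σ ζ

end Curves

/-! ### The locus `{f_t ^ N (z) = P_t}` in `𝔸¹ × U` -/

section Locus

variable {C : Scheme.{u}} (U : C.Opens)

/-- The affine line `𝔸¹ × U` over an open subscheme `U`. -/
abbrev line : Scheme.{u} := 𝔸(PUnit.{u + 1}; (U : Scheme.{u}))

/-- Regular functions on `U`, regarded as functions on `𝔸¹ × U`. -/
def pullbackFun : Γ(C, U) →+* Γ(line U, ⊤) :=
  (line U ↘ (U : Scheme.{u})).appTop.hom.comp U.topIso.inv.hom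

/-- The regular function `(z, t) ↦ f_t ^ N (z) - P_t` on `𝔸¹ × U`, where `f ^ N` is the
`N`-th iterate. -/
def locusFun (f : Γ(C, U)[X]) (P : Γ(C, U)) (N : ℕ) : Γ(line U, ⊤) :=
  (fun w => f.eval₂ (pullbackFun U) w)^[N] (AffineSpace.coord (U : Scheme.{u}) PUnit.unit) -
    pullbackFun U P

/-- The closed subset `{f_t ^ N (z) = P_t}` of `𝔸¹ × U`. -/
def locusSet (f : Γ(C, U)[X]) (P : Γ(C, U)) (N : ℕ) : TopologicalSpace.Closeds (line U) :=
  ((line U).basicOpen (locusFun U f P N)).compl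

/-- The closed subset `{f_t ^ N (z) = P_t}` of `𝔸¹ × U`, as a reduced closed subscheme. -/
def locus (f : Γ(C, U)[X]) (P : Γ(C, U)) (N : ℕ) : Scheme.{u} :=
  (Scheme.IdealSheafData.vanishingIdeal (locusSet U f P N)).subscheme

/-- The structure morphism of `{f_t ^ N (z) = P_t}` over `k`. -/
def locusStr {k : Type u} [Field k] (π : C ⟶ Spec (.of k))
    (f : Γ(C, U)[X]) (P : Γ(C, U)) (N : ℕ) : locus U f P N ⟶ Spec (.of k) :=
  (Scheme.IdealSheafData.vanishingIdeal (locusSet U f P N)).subschemeι ≫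
    (line U ↘ (U : Scheme.{u})) ≫ U.ι ≫ π

/-- `X` is the `N`-th preimage curve of `(f, P)` (with respect to an open set `U` on which `f` and
`P` are regular): a smooth projective model of `{f_t ^ N (z) = P_t} ⊆ 𝔸¹ × U`. -/
def IsPreimageCurve {k : Type u} [Field k] (π : C ⟶ Spec (.of k)) (f : Γ(C, U)[X]) (P : Γ(C, U))
    (N : ℕ) {X : Scheme.{u}} (σ : X ⟶ Spec (.of k)) : Prop :=
  IsSmoothProjectiveModel σ (locusStr U π f P N)

end Locus

end PreimageCurve

end

noncomputable section

namespace PreimageCurve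

/-! ### Iterates of polynomials -/

section Iterates

variable {R S : Type*} [CommRing R] [CommRing S]

/-! Irreducible components of the locus correspond to its points that are minimal under
specialization. They are either horizontal (over the generic point of `C`) or vertical (over another
point), and the two kinds are counted separately.

Horizontal components are the primes of `F[X]` containing `f ^ N (z) - P`, i.e. its irreducible
factors. Write `d = deg f`. Good reduction at `v` and the escape of `P` force every root `α` to
satisfy `|α| ^ (d ^ N) = |P| > 1`, so a monic factor `g` satisfies `|g 0| ^ (d ^ N) = |P| ^ deg g`.
As `v` is discrete, `d ^ N ≤ M * deg g` with `M` the pole order of `P` at `v`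
(`exists_natDegree_pow_le`), hence there are at most `M` factors. Substituting `f` never decreases
their number (`encard_primeSpectrum_le_comp`), so it stabilizes.

Vertical components are whole fibres, by Krull's principal ideal theorem
(`mem_minimalPrimes_span_iff_of_comap_C_eq`). The fibre over `t` occurs exactly when `f` reduces at
`t` to the constant `P_t`, a condition independent of `N ≥ 1` (`iterateSub_mem_map_C_iff`).

Finally, a smooth projective model has as many components as the locus, because both are noetherian
and share a dense open subscheme. -/

/-- The polynomial `f ^ N (z) - P`, where `f ^ N` is the `N`-th iterate of `f`. -/
def iterateSub (f : R[X]) (P : R) (N : ℕ) : R[X] := f.comp^[N] X - C P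

lemma iterate_comp_X_succ (f : R[X]) (N : ℕ) :
    f.comp^[N + 1] X = (f.comp^[N] X).comp f := by
  induction N with
  | zero => simp
  | succ n ih => rw [Function.iterate_succ_apply', ih, ← comp_assoc,
      ← Function.iterate_succ_apply' (f.comp), ih]

lemma iterateSub_succ (f : R[X]) (P : R) (N : ℕ) :
    iterateSub f P (N + 1) = (iterateSub f P N).comp f := by
  simp [iterateSub, iterate_comp_X_succ]

lemma map_iterateSub (φ : R →+* S) (f : R[X]) (P : R) (N : ℕ) :
    (iterateSub f P N).map φ = iterateSub (f.map φ) (φ P) N := by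
  have h : (f.comp^[N] X).map φ = (f.map φ).comp^[N] X := by
    induction N with
    | zero => simp
    | succ n ih => rw [Function.iterate_succ_apply', Function.iterate_succ_apply', map_comp, ih]
  simp [iterateSub, h]

lemma eval₂_iterateSub (φ : R →+* S) (f : R[X]) (P : R) (N : ℕ) (s : S) :
    (iterateSub f P N).eval₂ φ s = (fun w => f.eval₂ φ w)^[N] s - φ P := by
  have h : (f.comp^[N] X).eval₂ φ s = (fun w => f.eval₂ φ w)^[N] s := by
    induction N with
    | zero => simp
    | succ n ih => rw [Function.iterate_succ_apply', Function.iterate_succ_apply', eval₂_comp, ih]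
  simp [iterateSub, h]

lemma natDegree_iterate_comp_X [IsDomain R] (f : R[X]) (N : ℕ) :
    (f.comp^[N] X).natDegree = f.natDegree ^ N := by
  simp [natDegree_iterate_comp]

lemma natDegree_iterateSub [IsDomain R] (f : R[X]) (P : R) (N : ℕ) :
    (iterateSub f P N).natDegree = f.natDegree ^ N := by
  rw [iterateSub, natDegree_sub_C, natDegree_iterate_comp_X]

/-- At `N = 0` the polynomial is `X - C P`, which never vanishes; hence `N ≠ 0`. -/
lemma iterateSub_eq_zero_iff [IsDomain R] (f : R[X]) (P : R) {N : ℕ} (hN : N ≠ 0) :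
    iterateSub f P N = 0 ↔ f = C P := by
  obtain ⟨n, rfl⟩ := Nat.exists_eq_succ_of_ne_zero hN
  by_cases hf : f.natDegree = 0
  · obtain ⟨c, rfl⟩ := natDegree_eq_zero.mp hf
    simp [iterateSub, Function.iterate_succ_apply', sub_eq_zero]
  · refine iff_of_false (fun h => ?_) (fun h => hf (by simp [h]))
    have := natDegree_iterateSub f P (n + 1)
    rw [h, natDegree_zero] at this
    exact pow_ne_zero _ hf this.symm

end Iterates

/-! ### Growth of orbits -/

section Growth

variable {F : Type*} [Field F] {Γ₀ : Type*} [LinearOrderedCommGroupWithZero Γ₀]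

lemma valuation_eval_le_one (v : Valuation F Γ₀) {f : F[X]} (hf : ∀ i, v (f.coeff i) ≤ 1) {x : F}
    (hx : v x ≤ 1) : v (f.eval x) ≤ 1 := by
  rw [eval_eq_sum_range]
  refine v.map_sum_le fun i _ => ?_
  rw [map_mul, map_pow]
  exact mul_le_one' (hf i) (pow_le_one' hx i)

/-- Outside the unit ball the leading term strictly dominates all others. -/
lemma valuation_eval_of_one_lt (v : Valuation F Γ₀) {f : F[X]} (hf : ∀ i, v (f.coeff i) ≤ 1)
    (hlead : v f.leadingCoeff = 1) {x : F} (hx : 1 < v x) :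
    v (f.eval x) = v x ^ f.natDegree := by
  have h0 : v (f.leadingCoeff * x ^ f.natDegree) = v x ^ f.natDegree := by simp [hlead]
  rw [eval_eq_sum_range, Finset.sum_range_succ, add_comm, coeff_natDegree, ← h0]
  refine v.map_add_eq_of_lt_left (v.map_sum_lt ?_ fun i hi => ?_)
  · rw [h0]; exact (pow_pos (zero_lt_one.trans hx) _).ne'
  · rw [h0, map_mul, map_pow]
    refine (mul_le_of_le_one_left' (hf i)).trans_lt ?_
    exact pow_lt_pow_right₀ hx (Finset.mem_range.mp hi)

/-- The unit ball is stable under `f`, so if the `N`-th iterate lies outside it, all earlier ones do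
too and each step multiplies the exponent by the degree. -/
lemma valuation_iterate_eval (v : Valuation F Γ₀) {f : F[X]} (hf : ∀ i, v (f.coeff i) ≤ 1)
    (hlead : v f.leadingCoeff = 1) {x : F} (N : ℕ) (hx : 1 < v ((fun y => f.eval y)^[N] x)) :
    v ((fun y => f.eval y)^[N] x) = v x ^ f.natDegree ^ N := by
  induction N with
  | zero => simp
  | succ n ih =>
    rw [Function.iterate_succ_apply'] at hx ⊢
    have h1 : 1 < v ((fun y => f.eval y)^[n] x) := by
      by_contra! h
      exact hx.not_ge (valuation_eval_le_one v hf h)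
    rw [valuation_eval_of_one_lt v hf hlead h1, ih h1, pow_succ, pow_mul]

end Growth

section Factors

variable {F : Type u} [Field F]

lemma one_lt_valuation_of_notMem_filledJuliaSet {V : ValuationSubring F} {f : F[X]} {P : F}
    (hf : HasGoodReduction V f) (hP : P ∉ filledJuliaSet V f) :
    1 < V.valuation P ∧ f.natDegree ≠ 0 := by
  have hc : ∀ i, V.valuation (f.coeff i) ≤ 1 := fun i => (V.valuation_le_one_iff _).mpr (hf.1 i)
  have h1 : 1 < V.valuation P := by
    by_contra! h
    refine hP ⟨1, fun n => ?_⟩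
    induction n with
    | zero => exact h
    | succ n ih =>
      rw [Function.iterate_succ_apply']
      exact valuation_eval_le_one _ hc ih
  refine ⟨h1, fun h => hP ⟨V.valuation P, fun n => ?_⟩⟩
  obtain ⟨c, rfl⟩ := natDegree_eq_zero.mp h
  cases n with
  | zero => simp
  | succ n =>
    have := hf.2
    rw [leadingCoeff_C] at this
    simp only [Function.iterate_succ_apply', eval_C, this]
    exact h1.le

/-! ### Degrees of the irreducible factors -/

/-- A valuation ring of a field extends to every extension field. -/
lemma exists_valuationSubring_comap_eq {E : Type*} [Field E] [Algebra F E]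
    (V : ValuationSubring F) : ∃ W : ValuationSubring E, W.comap (algebraMap F E) = V := by
  obtain ⟨W, h, hloc⟩ :=
    IsLocalRing.exists_factor_valuationRing ((algebraMap F E).comp V.subtype)
  refine ⟨W, le_antisymm (fun x hx => ?_) fun x hx => h ⟨x, hx⟩⟩
  rcases V.mem_or_inv_mem x with hV | hV
  · exact hV
  by_cases hx0 : x = 0
  · simp [hx0]
  -- The map from `V` to `W` is local: `x⁻¹` becomes a unit in `W`, hence is already one in `V`.
  have hu : IsUnit (⟨x⁻¹, hV⟩ : V) := by
    refine hloc.map_nonunit _ (IsUnit.of_mul_eq_one ⟨algebraMap F E x, hx⟩ (Subtype.ext ?_))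
    simp [hx0]
  obtain ⟨y, hy⟩ := hu.exists_right_inv
  have hy' : x⁻¹ * (y : F) = 1 := congrArg Subtype.val hy
  have : x = y := by field_simp at hy'; exact hy'.symm
  exact this ▸ y.2

lemma valuation_le_one_iff_of_comap_eq {E : Type*} [Field E] [Algebra F E]
    {V : ValuationSubring F} {W : ValuationSubring E} (h : W.comap (algebraMap F E) = V) (x : F) :
    W.valuation (algebraMap F E x) ≤ 1 ↔ V.valuation x ≤ 1 := by
  rw [W.valuation_le_one_iff, V.valuation_le_one_iff, ← h, ValuationSubring.mem_comap]

/-- The two value groups differ, so only comparisons with `1` are carried from `V` to `W`. This is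
why `valuation_coeff_zero_pow` states its equality of values as a quotient of value `1`. -/
lemma valuation_eq_one_iff_of_comap_eq {E : Type*} [Field E] [Algebra F E]
    {V : ValuationSubring F} {W : ValuationSubring E} (h : W.comap (algebraMap F E) = V) (x : F) :
    W.valuation (algebraMap F E x) = 1 ↔ V.valuation x = 1 := by
  have key := (Valuation.isEquiv_iff_val_le_one (v := W.valuation.comap (algebraMap F E))
    (v' := V.valuation)).mpr fun {x} => valuation_le_one_iff_of_comap_eq h x
  exact Valuation.IsEquiv.eq_one_iff_eq_one key

/-- At a valuation ring where `f` has good reduction, an irreducible factor `g` of `f ^ N (z) - P`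
satisfies `v (g 0) ^ (d ^ N) = v P ^ deg g`. -/
lemma valuation_coeff_zero_pow {V : ValuationSubring F} {f : F[X]} {P : F}
    (hf : HasGoodReduction V f) (hP : 1 < V.valuation P) {g : F[X]} (hg : g.Monic) {N : ℕ}
    (hdvd : g ∣ iterateSub f P N) :
    V.valuation (g.coeff 0 ^ f.natDegree ^ N * P⁻¹ ^ g.natDegree) = 1 := by
  let E := AlgebraicClosure F
  obtain ⟨W, hW⟩ := exists_valuationSubring_comap_eq (E := E) V
  rw [← valuation_eq_one_iff_of_comap_eq hW]
  set ι := algebraMap F E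
  have hP' : 1 < W.valuation (ι P) := by
    rwa [← not_le, valuation_le_one_iff_of_comap_eq hW, not_le]
  have hP0 : W.valuation (ι P) ≠ 0 := (zero_lt_one.trans hP').ne'
  have hroot : ∀ α ∈ (g.map ι).roots, W.valuation α ^ f.natDegree ^ N = W.valuation (ι P) := by
    intro α hα
    have h1 : (iterateSub f P N).eval₂ ι α = 0 := by
      refine eval₂_eq_zero_of_dvd_of_eval₂_eq_zero ι α hdvd ?_
      rw [← Polynomial.eval_map]
      exact isRoot_of_mem_roots hα
    rw [eval₂_iterateSub, sub_eq_zero] at h1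
    simp only [← Polynomial.eval_map] at h1
    have h2 := valuation_iterate_eval W.valuation (f := f.map ι) (x := α) (fun i => ?_) ?_ N ?_
    · rw [h1, natDegree_map] at h2
      exact h2.symm
    · rw [coeff_map, valuation_le_one_iff_of_comap_eq hW]
      exact (V.valuation_le_one_iff _).mpr (hf.1 i)
    · rw [leadingCoeff_map, valuation_eq_one_iff_of_comap_eq hW]
      exact hf.2
    · rwa [h1]
  have hsplit : (g.map ι).Splits := IsAlgClosed.splits _
  have h0 := hsplit.coeff_zero_eq_prod_roots_of_monic (hg.map ι)
  have hcard : (g.map ι).roots.card = g.natDegree := by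
    rw [← natDegree_map ι]; exact hsplit.natDegree_eq_card_roots.symm
  have hv : W.valuation (ι (g.coeff 0)) ^ f.natDegree ^ N = W.valuation (ι P) ^ g.natDegree := by
    rw [← coeff_map, h0, map_mul, map_pow, Valuation.map_neg, map_one, one_pow, one_mul,
      map_multiset_prod, ← Multiset.prod_map_pow]
    rw [Multiset.map_congr rfl (g := fun _ => W.valuation (ι P))]
    · rw [Multiset.map_const', Multiset.prod_replicate, hcard]
    · intro α hα; exact hroot α hα
  simp only [map_mul, map_pow, map_inv₀, hv]
  rw [inv_pow, mul_inv_cancel₀ (pow_ne_zero _ hP0)]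

/-- If `P` escapes at a discrete valuation ring where `f` has good reduction, then the degrees of
the factors of `f ^ N (z) - P` are bounded below by a constant multiple of `d ^ N`. -/
lemma exists_natDegree_pow_le {V : ValuationSubring F} [IsDiscreteValuationRing V] {f : F[X]}
    {P : F} (hf : HasGoodReduction V f) (hP : 1 < V.valuation P) :
    ∃ M : ℕ, ∀ (N : ℕ) (g : F[X]), g.Monic → g.natDegree ≠ 0 → g ∣ iterateSub f P N →
      f.natDegree ^ N ≤ M * g.natDegree := by
  have hP0 : P ≠ 0 := by rintro rfl; simp at hP
  have hb : P⁻¹ ∈ V := by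
    rw [← V.valuation_le_one_iff, map_inv₀]; exact inv_le_one_of_one_le₀ hP.le
  have hb0 : (⟨P⁻¹, hb⟩ : V) ≠ 0 := by
    intro h; exact inv_ne_zero hP0 (congrArg Subtype.val h)
  -- The bound `M` is the normalized valuation of `P⁻¹`, i.e. the pole order of `P`.
  obtain ⟨M, hM⟩ := ENat.ne_top_iff_exists.mp
    (mt IsDiscreteValuationRing.addVal_eq_top_iff.mp hb0)
  have hMpos : M ≠ 0 := by
    rintro rfl
    have hu : IsUnit (⟨P⁻¹, hb⟩ : V) := by
      rw [← IsDiscreteValuationRing.addVal_eq_zero_iff, ← hM]; rfl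
    have := (V.valuation_eq_one_iff _).mp hu
    simp only [map_inv₀, inv_eq_one] at this
    exact hP.ne' this
  refine ⟨M, fun N g hg hdeg hdvd => ?_⟩
  have key := valuation_coeff_zero_pow hf hP hg hdvd
  by_cases hd : f.natDegree ^ N = 0
  · omega
  have hg0 : g.coeff 0 ≠ 0 := by
    intro h; rw [h, zero_pow hd] at key; simp at key
  have key2 : V.valuation (g.coeff 0) ^ f.natDegree ^ N = V.valuation P ^ g.natDegree := by
    simp only [map_mul, map_pow, map_inv₀, inv_pow] at key
    exact (mul_inv_eq_one₀ (pow_ne_zero _ (zero_lt_one.trans hP).ne')).mp key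
  have ha : (g.coeff 0)⁻¹ ∈ V := by
    rw [← V.valuation_le_one_iff, map_inv₀]
    refine inv_le_one_of_one_le₀ ?_
    rw [← one_le_pow_iff_of_nonneg zero_le hd, key2]
    exact one_le_pow₀ hP.le
  -- Equality of values becomes association in `V`, which makes the integer-valued `addVal`
  -- applicable.
  have hassoc : Associated ((⟨(g.coeff 0)⁻¹, ha⟩ : V) ^ f.natDegree ^ N)
      ((⟨P⁻¹, hb⟩ : V) ^ g.natDegree) := by
    obtain ⟨u, hu⟩ := (V.valuation_eq_iff (P⁻¹ ^ g.natDegree)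
      ((g.coeff 0)⁻¹ ^ f.natDegree ^ N)).mp (by simp [key2])
    exact ⟨u, Subtype.ext (by simpa [mul_comm] using hu)⟩
  have h3 := (IsDiscreteValuationRing.addVal_eq_iff_associated _ _).mpr hassoc
  have ha0 : (⟨(g.coeff 0)⁻¹, ha⟩ : V) ≠ 0 := by
    intro h; exact inv_ne_zero hg0 (congrArg Subtype.val h)
  obtain ⟨a, haM⟩ := ENat.ne_top_iff_exists.mp
    (mt IsDiscreteValuationRing.addVal_eq_top_iff.mp ha0)
  rw [IsDiscreteValuationRing.addVal_pow, IsDiscreteValuationRing.addVal_pow, ← hM, ← haM,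
    nsmul_eq_mul, nsmul_eq_mul] at h3
  have h4 : f.natDegree ^ N * a = g.natDegree * M := by exact_mod_cast h3
  have ha1 : a ≠ 0 := by
    rintro rfl
    exact mul_ne_zero hdeg hMpos (by simpa using h4.symm)
  calc f.natDegree ^ N ≤ f.natDegree ^ N * a := Nat.le_mul_of_pos_right _ (Nat.pos_of_ne_zero ha1)
    _ = M * g.natDegree := by rw [h4, mul_comm]

end Factors

/-! ### Counting prime ideals containing `f ^ N (z) - P` -/

section Counting

variable {F : Type u} [Field F]

/-- If all nonconstant monic factors of `h` have degree at least `deg h / M`, then `h` lies in at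
most `M` prime ideals. -/
lemma encard_primeSpectrum_le {h : F[X]} (h0 : 0 < h.natDegree) {M : ℕ}
    (hM : ∀ g : F[X], g.Monic → g.natDegree ≠ 0 → g ∣ h → h.natDegree ≤ M * g.natDegree) :
    {p : PrimeSpectrum F[X] | h ∈ p.asIdeal}.encard ≤ M := by
  classical
  have hne : h ≠ 0 := by rintro rfl; simp at h0
  set s := UniqueFactorizationMonoid.normalizedFactors h
  have hs : ∀ q ∈ s, Irreducible q ∧ q.Monic ∧ q ∣ h := fun q hq =>
    (Polynomial.mem_normalizedFactors_iff hne).mp hq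
  have hsub : PrimeSpectrum.asIdeal '' {p : PrimeSpectrum F[X] | h ∈ p.asIdeal} ⊆
      (fun q => Ideal.span {q}) '' (s.toFinset : Set F[X]) := by
    rintro _ ⟨p, hp, rfl⟩
    obtain ⟨g, hg⟩ := (IsPrincipalIdealRing.principal p.asIdeal).principal
    rw [← Ideal.span] at hg
    have hgh : g ∣ h := by
      rw [Set.mem_ofPred_eq, hg, Ideal.mem_span_singleton] at hp; exact hp
    have hg0 : g ≠ 0 := by rintro rfl; exact hne (zero_dvd_iff.mp hgh)
    have hgp : Prime g := (Ideal.span_singleton_prime hg0).mp (hg ▸ p.2)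
    obtain ⟨q, hq, hgq⟩ :=
      UniqueFactorizationMonoid.exists_mem_normalizedFactors_of_dvd hne hgp.irreducible hgh
    exact ⟨q, by simpa using hq, by
      rw [hg]; exact (Ideal.span_singleton_eq_span_singleton.mpr hgq).symm⟩
  have hinj : Function.Injective (PrimeSpectrum.asIdeal (R := F[X])) := fun p q => PrimeSpectrum.ext
  rw [← hinj.encard_image]
  refine (Set.encard_le_encard hsub).trans ((Set.encard_image_le _ _).trans ?_)
  rw [Set.encard_coe_eq_coe_finsetCard, Nat.cast_le]
  -- Multiplied by `deg h`, the claim follows by summing the degree bound over the distinct factors.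
  refine Nat.le_of_mul_le_mul_right ?_ h0
  have hprod : s.prod.natDegree ≤ h.natDegree := by
    refine natDegree_le_of_dvd ?_ hne
    exact (UniqueFactorizationMonoid.prod_normalizedFactors hne).dvd
  have hsum : (s.map natDegree).sum = s.prod.natDegree :=
    (natDegree_multiset_prod_of_monic s fun q hq => (hs q hq).2.1).symm
  calc s.toFinset.card * h.natDegree = ∑ q ∈ s.toFinset, h.natDegree := by simp
    _ ≤ ∑ q ∈ s.toFinset, M * q.natDegree := Finset.sum_le_sum fun q hq => by
        obtain ⟨h1, h2, h3⟩ := hs q (Multiset.mem_toFinset.mp hq)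
        exact hM q h2 h1.natDegree_pos.ne' h3
    _ = M * (s.dedup.map natDegree).sum := by rw [← Finset.mul_sum]; rfl
    _ ≤ M * (s.map natDegree).sum := by
        gcongr
        obtain ⟨t, ht⟩ := Multiset.le_iff_exists_add.mp (Multiset.dedup_le s)
        conv_rhs => rw [ht, Multiset.map_add, Multiset.sum_add]
        exact Nat.le_add_right _ _
    _ ≤ M * h.natDegree := by rw [hsum]; gcongr

/-- Every prime ideal containing `h` is the preimage, under substitution of a nonconstant
polynomial `f`, of a prime ideal containing `h ∘ f`. -/
lemma encard_primeSpectrum_le_comp {f h : F[X]} (hf : f.natDegree ≠ 0) (h0 : h ≠ 0) :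
    {p : PrimeSpectrum F[X] | h ∈ p.asIdeal}.encard ≤
      {p : PrimeSpectrum F[X] | h.comp f ∈ p.asIdeal}.encard := by
  let φ : F[X] →+* F[X] := compRingHom f
  have hsub : {p : PrimeSpectrum F[X] | h ∈ p.asIdeal} ⊆
      PrimeSpectrum.comap φ '' {p : PrimeSpectrum F[X] | h.comp f ∈ p.asIdeal} := by
    intro p hp
    obtain ⟨g, hg⟩ := (IsPrincipalIdealRing.principal p.asIdeal).principal
    rw [← Ideal.span] at hg
    have hgh : g ∣ h := by
      rw [Set.mem_ofPred_eq, hg, Ideal.mem_span_singleton] at hp; exact hp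
    have hg0 : g ≠ 0 := by rintro rfl; exact h0 (zero_dvd_iff.mp hgh)
    have hgp : Irreducible g := ((Ideal.span_singleton_prime hg0).mp (hg ▸ p.2)).irreducible
    have hmax : (Ideal.span {g}).IsMaximal := PrincipalIdealRing.isMaximal_of_irreducible hgp
    have hunit : ¬ IsUnit (g.comp f) := by
      refine not_isUnit_of_natDegree_pos _ ?_
      rw [natDegree_comp]
      exact Nat.mul_pos hgp.natDegree_pos (Nat.pos_of_ne_zero hf)
    -- A maximal ideal over `g ∘ f` contracts to a proper ideal containing the maximal ideal `(g)`,
    -- hence to `(g)` itself.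
    obtain ⟨q, hq, hgq⟩ := Ideal.exists_le_maximal (Ideal.span {g.comp f})
      (mt Ideal.span_singleton_eq_top.mp hunit)
    have hle : Ideal.span {g} ≤ q.comap φ := by
      rw [Ideal.span_singleton_le_iff_mem]
      exact hgq (Ideal.mem_span_singleton_self _)
    have heq := hmax.eq_of_le (Ideal.comap_ne_top φ hq.ne_top) hle
    refine ⟨⟨q, hq.isPrime⟩, ?_, PrimeSpectrum.ext ?_⟩
    · have : h ∈ q.comap φ := heq ▸ hg ▸ hp
      exact this
    · rw [hg, heq]; rfl
  exact (Set.encard_le_encard hsub).trans (Set.encard_image_le _ _)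

/-- A monotone bounded sequence of extended natural numbers is eventually constant. -/
lemma exists_eventually_eq_of_monotone {e : ℕ → ℕ∞} (he : Monotone e) {M : ℕ}
    (hM : ∀ n, e n ≤ M) : ∃ c N₀ : ℕ, ∀ n ≥ N₀, e n = c := by
  have hfin : ∀ n, e n ≠ ⊤ := fun n => ne_top_of_le_ne_top (ENat.natCast_ne_top M) (hM n)
  have hbdd : BddAbove (Set.range fun n => (e n).toNat) := by
    refine ⟨M, ?_⟩
    rintro _ ⟨n, rfl⟩
    exact ENat.toNat_le_of_le_natCast (hM n)
  obtain ⟨N₀, hN₀⟩ := Nat.sSup_mem (Set.range_nonempty _) hbdd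
  refine ⟨(e N₀).toNat, N₀, fun n hn => ?_⟩
  rw [ENat.natCast_toNat (hfin N₀)]
  refine le_antisymm ?_ (he hn)
  rw [← ENat.natCast_toNat (hfin n), ← ENat.natCast_toNat (hfin N₀), Nat.cast_le]
  exact (le_csSup hbdd ⟨n, rfl⟩).trans hN₀.ge

/-- The number of irreducible factors of `f ^ N (z) - P` is eventually constant, if there is a
discrete valuation ring at which `f` has good reduction and the orbit of `P` is unbounded. -/
lemma exists_encard_primeSpectrum_eq {V : ValuationSubring F} [IsDiscreteValuationRing V] {f : F[X]}
    {P : F} (hf : HasGoodReduction V f) (hP : P ∉ filledJuliaSet V f) :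
    ∃ c N₀ : ℕ, ∀ N ≥ N₀,
      {p : PrimeSpectrum F[X] | iterateSub f P N ∈ p.asIdeal}.encard = c := by
  obtain ⟨hP1, hd⟩ := one_lt_valuation_of_notMem_filledJuliaSet hf hP
  obtain ⟨M, hM⟩ := exists_natDegree_pow_le hf hP1
  have hpos : ∀ N, 0 < (iterateSub f P N).natDegree := fun N => by
    rw [natDegree_iterateSub]; exact pow_pos (Nat.pos_of_ne_zero hd) N
  refine exists_eventually_eq_of_monotone (monotone_nat_of_le_succ fun N => ?_)
    (M := M) fun N => encard_primeSpectrum_le (hpos N) fun g hg h0 hdvd => ?_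
  · rw [iterateSub_succ]
    exact encard_primeSpectrum_le_comp hd (ne_zero_of_natDegree_gt (hpos N))
  · rw [natDegree_iterateSub]; exact hM N g hg h0 hdvd

end Counting

/-! ### Minimal primes over the closed points of a one-dimensional base -/

section Vertical

variable {R : Type*} [CommRing R]

/-- A prime minimal over one element has height at most `1`, while `m.map C` lies below `p` and
already has height `m.height ≥ 1`; so the two agree. Conversely, a prime strictly below `m.map C`
has height `0`, so it is zero and misses `h`. -/
lemma mem_minimalPrimes_span_iff_of_comap_C_eq [IsDomain R] [IsNoetherianRing R]
    {m : Ideal R} [m.IsMaximal] (hm : m ≠ ⊥)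
    (hht : m.height ≤ 1) {h : R[X]} (h0 : h ≠ 0) {p : Ideal R[X]} [p.IsPrime]
    (hp : p.comap C = m) :
    p ∈ (Ideal.span {h}).minimalPrimes ↔ p = m.map C ∧ h ∈ m.map C := by
  have hprime : (m.map (C : R →+* R[X])).IsPrime := Ideal.isPrime_map_C_of_isPrime
  constructor
  · intro hmin
    have h1 := Ideal.height_le_one_of_isPrincipal_of_mem_minimalPrimes _ p hmin
    have hle : m.map C ≤ p := Ideal.map_le_iff_le_comap.mpr hp.ge
    have heq : p = m.map C := by
      by_contra hne
      have hlt := Ideal.height_strict_mono_of_isPrime (lt_of_le_of_ne hle (Ne.symm hne))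
      rw [height_map_C] at hlt
      have := Order.lt_one_iff.mp (hlt.trans_le h1)
      exact hm (Ideal.height_eq_zero_iff_eq_bot.mp this)
    exact ⟨heq, heq ▸ hmin.1.2 (Ideal.mem_span_singleton_self h)⟩
  · rintro ⟨rfl, hh⟩
    refine ⟨⟨hprime, (Ideal.span_singleton_le_iff_mem _).mpr hh⟩, fun q hq hqp => ?_⟩
    have := hq.1
    by_contra hne
    have hlt := Ideal.height_strict_mono_of_isPrime (lt_of_le_not_ge hqp hne)
    rw [height_map_C] at hlt
    have := Order.lt_one_iff.mp (hlt.trans_le hht)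
    rw [Ideal.height_eq_zero_iff_eq_bot] at this
    exact h0 (by simpa [this] using hq.2)

/-- `m.map C` is the kernel of coefficientwise reduction to the domain `R ⧸ m`. The right-hand side
does not involve `N`, so the vertical components are the same for all `N ≥ 1`. -/
lemma iterateSub_mem_map_C_iff (m : Ideal R) [m.IsPrime] (f : R[X]) (P : R) {N : ℕ} (hN : N ≠ 0) :
    iterateSub f P N ∈ m.map C ↔ f.map (Ideal.Quotient.mk m) = C (Ideal.Quotient.mk m P) := by
  rw [← iterateSub_eq_zero_iff _ _ hN, ← map_iterateSub, ← Ideal.mk_ker (I := m),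
    ← Polynomial.ker_mapRingHom, RingHom.mem_ker, Ideal.mk_ker]
  rfl

end Vertical

/-! ### Irreducible components -/

section Components

variable {T T' : Type*} [TopologicalSpace T] [TopologicalSpace T']

/-- A dense open subset meeting all irreducible components has as many irreducible components as
the whole space, if there are finitely many of these. -/
lemma encard_irreducibleComponents_eq_of_isOpenEmbedding
    (hfin : (irreducibleComponents T).Finite) {j : T' → T} (hj : Topology.IsOpenEmbedding j)
    (hd : DenseRange j) : (irreducibleComponents T').encard = (irreducibleComponents T).encard := by
  -- By finiteness, the complement of the other components is a nonempty open subset of `Z`, which a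
  -- dense image must meet.
  have hmeet : ∀ Z ∈ irreducibleComponents T, (Z ∩ Set.range j).Nonempty := by
    intro Z hZ
    have hcl := closure_sUnion_irreducibleComponents_sdiff_singleton hfin Z hZ
    have hopen : IsOpen (⋃₀ (irreducibleComponents T \ {Z}))ᶜ := by
      rw [Set.sUnion_eq_biUnion, isOpen_compl_iff]
      exact hfin.sdiff.isClosed_biUnion fun W hW => isClosed_of_mem_irreducibleComponents W hW.1
    have hne : ((⋃₀ (irreducibleComponents T \ {Z}))ᶜ).Nonempty := by
      rw [← closure_nonempty_iff, hcl]; exact hZ.1.1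
    obtain ⟨y, hx⟩ := hd.exists_mem_open hopen hne
    exact ⟨j y, hcl ▸ subset_closure hx, y, rfl⟩
  have hclosure : ∀ Z ∈ irreducibleComponents T, closure (j '' (j ⁻¹' Z)) = Z := fun Z hZ =>
    closure_image_preimage_of_isPreirreducible j hj.isOpenMap Z
      (by obtain ⟨_, hx, y, rfl⟩ := hmeet Z hZ; exact ⟨y, hx⟩) hZ.1.2
      (isClosed_of_mem_irreducibleComponents Z hZ)
  have himage : (j ⁻¹' ·) '' irreducibleComponents T = irreducibleComponents T' := by
    ext W
    constructor
    · rintro ⟨Z, hZ, rfl⟩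
      exact preimage_mem_irreducibleComponents hZ hj (hmeet Z hZ)
    · intro hW
      obtain ⟨Z, hZ, hWZ⟩ := exists_mem_irreducibleComponents_subset_of_isIrreducible _
        (hW.1.image j hj.continuous.continuousOn)
      have h1 := preimage_mem_irreducibleComponents hZ hj (hmeet Z hZ)
      have h2 : W ⊆ j ⁻¹' Z := Set.image_subset_iff.mp hWZ
      exact ⟨Z, hZ, (h2.antisymm (hW.2 h1.1 h2)).symm⟩
  rw [← himage]
  refine Set.InjOn.encard_image fun Z hZ Z' hZ' h => ?_
  rw [← hclosure Z hZ, ← hclosure Z' hZ']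
  exact congrArg (fun s => closure (j '' s)) h

/-- The points of `Z` which are not proper specializations of points of `Z`. -/
def minimalPoints (Z : Set T) : Set T := {x | x ∈ Z ∧ ∀ y ∈ Z, y ⤳ x → y = x}

lemma mem_genericPoints_iff [QuasiSober T] [T0Space T] {x : T} :
    x ∈ genericPoints T ↔ ∀ y, y ⤳ x → y = x := by
  constructor
  · intro hx y hy
    have h1 : closure {x} ⊆ closure {y} := specializes_iff_closure_subset.mp hy
    have h2 := hx.2 isIrreducible_singleton.closure h1
    exact (hy.antisymm (specializes_iff_closure_subset.mpr h2)).eq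
  · intro h
    refine ⟨isIrreducible_singleton.closure, fun s hs hle => ?_⟩
    have hg := hs.isGenericPoint_genericPoint_closure
    have hy : hs.genericPoint ⤳ x := by
      rw [specializes_iff_mem_closure, hg.def]
      exact subset_closure (hle (subset_closure rfl))
    rw [← h _ hy, hg.def]
    exact subset_closure

/-- Each component has a unique generic point, and specialization in the subspace is that of the
ambient space. -/
lemma encard_irreducibleComponents_eq_encard_minimalPoints [QuasiSober T'] [T0Space T']
    {i : T' → T} (hi : Topology.IsEmbedding i) :
    (irreducibleComponents T').encard = (minimalPoints (Set.range i)).encard := by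
  have h1 : (irreducibleComponents T').encard = (genericPoints T').encard :=
    (Set.encard_congr genericPoints.equiv).symm
  have h2 : minimalPoints (Set.range i) = i '' genericPoints T' := by
    ext x
    constructor
    · rintro ⟨⟨y, rfl⟩, h⟩
      refine ⟨y, mem_genericPoints_iff.mpr fun z hz => ?_, rfl⟩
      exact hi.injective (h _ ⟨z, rfl⟩ (hz.map hi.continuous))
    · rintro ⟨y, hy, rfl⟩
      refine ⟨⟨y, rfl⟩, ?_⟩
      rintro _ ⟨z, rfl⟩ hz
      rw [mem_genericPoints_iff.mp hy z (hi.isInducing.specializes_iff.mp hz)]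
  rw [h1, h2, hi.injective.encard_image]

/-- Minimal points can be computed in a subspace stable under generalization. -/
lemma mem_minimalPoints_preimage_iff {i : T' → T} (hi : Topology.IsEmbedding i)
    (hgen : StableUnderGeneralization (Set.range i)) {Z : Set T} {x : T'} :
    x ∈ minimalPoints (i ⁻¹' Z) ↔ i x ∈ minimalPoints Z := by
  constructor
  · rintro ⟨h1, h2⟩
    refine ⟨h1, fun y hy hyx => ?_⟩
    obtain ⟨z, rfl⟩ := hgen hyx ⟨x, rfl⟩
    rw [h2 z hy (hi.isInducing.specializes_iff.mp hyx)]
  · rintro ⟨h1, h2⟩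
    exact ⟨h1, fun y hy hyx => hi.injective (h2 _ hy (hyx.map hi.continuous))⟩

lemma mem_minimalPoints_zeroLocus_iff {A : Type*} [CommRing A] {h : A} {p : PrimeSpectrum A} :
    p ∈ minimalPoints (PrimeSpectrum.zeroLocus {h}) ↔
      p.asIdeal ∈ (Ideal.span {h}).minimalPrimes := by
  constructor
  · rintro ⟨h1, h2⟩
    refine ⟨⟨p.2, (Ideal.span_le).mpr h1⟩, fun q hq hqp => ?_⟩
    have := h2 ⟨q, hq.1⟩ (Ideal.span_le.mp hq.2) ((PrimeSpectrum.le_iff_specializes _ _).mp hqp)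
    exact (congrArg PrimeSpectrum.asIdeal this).ge
  · rintro ⟨h1, h2⟩
    refine ⟨Ideal.span_le.mp h1.2, fun q hq hqp => ?_⟩
    have hle : q ≤ p := (PrimeSpectrum.le_iff_specializes _ _).mpr hqp
    exact le_antisymm hle (h2 ⟨q.2, Ideal.span_le.mpr hq⟩ hle)

end Components

/-! ### The locus near a point of the base -/

section LocalModel

variable {C : Scheme.{u}} (U : C.Opens)

instance (t : C) (ht : t ∈ U) : IsPreimmersion (U.fromSpecStalkOfMem t ht) := by
  have : IsPreimmersion (U.fromSpecStalkOfMem t ht ≫ U.ι) := by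
    rw [Scheme.Opens.fromSpecStalkOfMem_ι]; infer_instance
  exact IsPreimmersion.of_comp _ U.ι

/-- Pulling a function on `U` back to the spectrum of the stalk amounts to taking its germ. -/
lemma topIso_inv_comp_fromSpecStalkOfMem_appTop (t : C) (ht : t ∈ U) :
    U.topIso.inv ≫ (U.fromSpecStalkOfMem t ht).appTop =
      C.presheaf.germ U t ht ≫ (Scheme.ΓSpecIso (C.presheaf.stalk t)).inv := by
  have h := congrArg Scheme.Hom.appTop (U.fromSpecStalkOfMem_toSpecΓ t ht)
  rw [Scheme.Hom.comp_appTop, Scheme.Opens.toSpecΓ, Scheme.Hom.comp_appTop,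
    Scheme.toSpecΓ_appTop] at h
  rw [← cancel_epi (Scheme.ΓSpecIso _).hom, ← Scheme.ΓSpecIso_naturality_assoc]
  rw [Category.assoc] at h
  rw [h, ← Category.assoc, ← Scheme.ΓSpecIso_naturality, Category.assoc, Iso.hom_inv_id,
    Category.comp_id]

/-- The inclusion of a ring into the polynomial ring. -/
def constantPolynomial (R : CommRingCat.{u}) : R ⟶ CommRingCat.of R[X] :=
  CommRingCat.ofHom Polynomial.C

/-- Polynomials in one variable, as multivariate polynomials. -/
def polynomialIso (R : CommRingCat.{u}) :
    CommRingCat.of (MvPolynomial PUnit.{u + 1} R) ≅ CommRingCat.of R[X] :=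
  (MvPolynomial.uniqueAlgEquiv R PUnit).toRingEquiv.toCommRingCatIso

lemma polynomialIso_hom_C (R : CommRingCat.{u}) (a : R) :
    (polynomialIso R).hom (MvPolynomial.C a) = Polynomial.C a :=
  (MvPolynomial.uniqueAlgEquiv R PUnit).commutes a

lemma polynomialIso_hom_X (R : CommRingCat.{u}) (i : PUnit) :
    (polynomialIso R).hom (MvPolynomial.X i) = X :=
  MvPolynomial.aeval_X _ _

/-- The affine line over the local ring at a point of `U`, mapping to the affine line over `U`. -/
def lineAt (t : C) (ht : t ∈ U) : Spec (.of (C.presheaf.stalk t)[X]) ⟶ line U :=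
  Spec.map (polynomialIso (C.presheaf.stalk t)).hom ≫
    (AffineSpace.SpecIso PUnit (C.presheaf.stalk t)).inv ≫
      AffineSpace.map PUnit (U.fromSpecStalkOfMem t ht)

instance (t : C) (ht : t ∈ U) :
    IsPreimmersion (AffineSpace.map PUnit.{u + 1} (U.fromSpecStalkOfMem t ht)) :=
  MorphismProperty.of_isPullback (AffineSpace.isPullback_map _).flip inferInstance

instance (t : C) (ht : t ∈ U) : IsPreimmersion (lineAt U t ht) := by
  unfold lineAt; infer_instance

lemma lineAt_over (t : C) (ht : t ∈ U) : lineAt U t ht ≫ (line U ↘ (U : Scheme.{u})) =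
    Spec.map (constantPolynomial (C.presheaf.stalk t)) ≫ U.fromSpecStalkOfMem t ht := by
  simp only [lineAt, Category.assoc, AffineSpace.map_over, AffineSpace.SpecIso_inv_over_assoc]
  rw [← Spec.map_comp_assoc]
  congr 2
  ext x : 2
  exact polynomialIso_hom_C _ x

lemma lineAt_appTop_coord (t : C) (ht : t ∈ U) :
    (lineAt U t ht).appTop (AffineSpace.coord (U : Scheme.{u}) PUnit.unit) =
      (Scheme.ΓSpecIso (.of (C.presheaf.stalk t)[X])).inv X := by
  simp only [lineAt, Scheme.Hom.comp_appTop, CommRingCat.comp_apply, AffineSpace.map_appTop_coord]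
  rw [AffineSpace.SpecIso_inv_appTop_coord, ← CommRingCat.comp_apply,
    ← Scheme.ΓSpecIso_inv_naturality, CommRingCat.comp_apply]
  exact congrArg _ (polynomialIso_hom_X _ _)

lemma lineAt_appTop_pullbackFun (t : C) (ht : t ∈ U) (a : Γ(C, U)) :
    (lineAt U t ht).appTop (pullbackFun U a) =
      (Scheme.ΓSpecIso (.of (C.presheaf.stalk t)[X])).inv
        (Polynomial.C (C.presheaf.germ U t ht a)) := by
  have h1 := congrArg Scheme.Hom.appTop (lineAt_over U t ht)
  rw [Scheme.Hom.comp_appTop, Scheme.Hom.comp_appTop] at h1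
  have h2 := congrArg (U.topIso.inv ≫ ·) h1
  rw [← Category.assoc U.topIso.inv (Scheme.Hom.appTop (U.fromSpecStalkOfMem t ht)),
    topIso_inv_comp_fromSpecStalkOfMem_appTop, Category.assoc,
    ← Scheme.ΓSpecIso_inv_naturality] at h2
  exact congrArg (fun φ => φ.hom a) h2

lemma lineAt_appTop_locusFun (t : C) (ht : t ∈ U) (f : Γ(C, U)[X]) (P : Γ(C, U)) (N : ℕ) :
    (lineAt U t ht).appTop (locusFun U f P N) =
      (Scheme.ΓSpecIso (.of (C.presheaf.stalk t)[X])).inv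
        (iterateSub (f.map (C.presheaf.germ U t ht).hom) (C.presheaf.germ U t ht P) N) := by
  have h : (lineAt U t ht).appTop.hom.comp (pullbackFun U) =
      ((Scheme.ΓSpecIso (.of (C.presheaf.stalk t)[X])).inv.hom.comp Polynomial.C).comp
        (C.presheaf.germ U t ht).hom :=
    RingHom.ext fun a => lineAt_appTop_pullbackFun U t ht a
  have h1 : (iterateSub f P N).eval₂ (pullbackFun U) (AffineSpace.coord _ PUnit.unit) =
    locusFun U f P N := eval₂_iterateSub _ _ _ _ _
  have h2 := map_iterateSub (C.presheaf.germ U t ht).hom f P N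
  rw [← h1]
  refine (hom_eval₂ _ _ (lineAt U t ht).appTop.hom _).trans ?_
  rw [h, ← eval₂_map, h2]
  refine (congrArg (fun w => eval₂ _ w _) (lineAt_appTop_coord U t ht)).trans ?_
  refine (hom_eval₂ _ _ _ _).symm.trans ?_
  rw [eval₂_C_X]

lemma lineAt_preimage_locusSet (t : C) (ht : t ∈ U) (f : Γ(C, U)[X]) (P : Γ(C, U)) (N : ℕ) :
    lineAt U t ht ⁻¹' (locusSet U f P N : Set (line U)) =
      PrimeSpectrum.zeroLocus
        {iterateSub (f.map (C.presheaf.germ U t ht).hom) (C.presheaf.germ U t ht P) N} := by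
  have h : lineAt U t ht ⁻¹ᵁ (line U).basicOpen (locusFun U f P N) = _ :=
    Scheme.preimage_basicOpen_top (lineAt U t ht) (locusFun U f P N)
  rw [lineAt_appTop_locusFun, basicOpen_eq_of_affine] at h
  have h' := congrArg (fun W => (SetLike.coe W)ᶜ) h
  refine h'.trans ((congrArg _ (PrimeSpectrum.basicOpen_eq_zeroLocus_compl _)).trans ?_)
  exact compl_compl _

lemma lineAt_base (t : C) (ht : t ∈ U) (y : Spec (.of (C.presheaf.stalk t)[X])) :
    U.ι ((line U ↘ (U : Scheme.{u})) (lineAt U t ht y)) =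
      C.fromSpecStalk t (Spec.map (constantPolynomial (C.presheaf.stalk t)) y) := by
  rw [← Scheme.Hom.comp_apply (lineAt U t ht), lineAt_over, ← U.fromSpecStalkOfMem_ι t ht]
  rfl

/-- `lineAt` is, up to isomorphism, the base change of `Spec` of the stalk, whose image in `C` is
the set of generalizations of `t`. -/
lemma range_lineAt (t : C) (ht : t ∈ U) : Set.range (lineAt U t ht) =
    {x | U.ι ((line U ↘ (U : Scheme.{u})) x) ⤳ t} := by
  ext x
  constructor
  · rintro ⟨y, rfl⟩
    have h' : C.fromSpecStalk t (Spec.map (constantPolynomial (C.presheaf.stalk t)) y) ∈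
      Set.range (C.fromSpecStalk t) := ⟨_, rfl⟩
    rw [Scheme.range_fromSpecStalk] at h'
    exact (specializes_of_eq (lineAt_base U t ht y)).trans h'
  · intro hx
    have hx' : U.ι ((line U ↘ (U : Scheme.{u})) x) ∈ Set.range (C.fromSpecStalk t) := by
      rw [Scheme.range_fromSpecStalk]; exact hx
    obtain ⟨y, hy⟩ := hx'
    rw [← U.fromSpecStalkOfMem_ι t ht, Scheme.Hom.comp_apply] at hy
    obtain ⟨z, hz, -⟩ := Scheme.exists_preimage_of_isPullback
      (AffineSpace.isPullback_map (n := PUnit) (U.fromSpecStalkOfMem t ht)) x y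
      (U.ι.injective hy.symm)
    obtain ⟨w, hw⟩ := (Spec.map (polynomialIso (C.presheaf.stalk t)).hom ≫
      (AffineSpace.SpecIso PUnit (C.presheaf.stalk t)).inv).surjective z
    refine ⟨w, ?_⟩
    rw [lineAt, ← Category.assoc, Scheme.Hom.comp_apply, hw, hz]

end LocalModel

/-! ### Horizontal and vertical components of the locus -/

section LocusComponents

variable {C : Scheme.{u}} (U : C.Opens)

/-- The image in `C` of a point of `𝔸¹ × U`. -/
def basePoint (x : line U) : C := U.ι ((line U ↘ (U : Scheme.{u})) x)

lemma basePoint_mem (x : line U) : basePoint U x ∈ U :=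
  ((line U ↘ (U : Scheme.{u})) x).2

lemma stableUnderGeneralization_range_lineAt (t : C) (ht : t ∈ U) :
    StableUnderGeneralization (Set.range (lineAt U t ht)) := by
  rw [range_lineAt]
  intro x y hyx hx
  exact ((hyx.map (line U ↘ (U : Scheme.{u})).continuous).map U.ι.continuous).trans hx

/-- This reduces both kinds of components to algebra over a stalk: the function field for horizontal
ones, a local ring of dimension one for vertical ones. -/
lemma lineAt_mem_minimalPoints_iff (t : C) (ht : t ∈ U) (f : Γ(C, U)[X]) (P : Γ(C, U)) (N : ℕ)
    (y : Spec (.of (C.presheaf.stalk t)[X])) :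
    lineAt U t ht y ∈ minimalPoints (locusSet U f P N : Set (line U)) ↔
      y.asIdeal ∈ (Ideal.span {iterateSub (f.map (C.presheaf.germ U t ht).hom)
        (C.presheaf.germ U t ht P) N}).minimalPrimes := by
  refine Iff.trans ?_ mem_minimalPoints_zeroLocus_iff
  rw [← mem_minimalPoints_preimage_iff (lineAt U t ht).isEmbedding
    (stableUnderGeneralization_range_lineAt U t ht), lineAt_preimage_locusSet]
  rfl

lemma height_maximalIdeal_stalk_le (hdim : topologicalKrullDim C = 1) (t : C) :
    (IsLocalRing.maximalIdeal (C.presheaf.stalk t)).height ≤ 1 := by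
  have h1 := Ideal.height_le_ringKrullDim_of_ne_top
    (I := IsLocalRing.maximalIdeal (C.presheaf.stalk t)) Ideal.IsPrime.ne_top'
  have h2 := (C.fromSpecStalk t).isEmbedding.isInducing.topologicalKrullDim_le
  have h3 := PrimeSpectrum.topologicalKrullDim_eq_ringKrullDim (R := C.presheaf.stalk t)
  have h4 := h1.trans (h3.ge.trans (h2.trans hdim.le))
  exact_mod_cast h4

variable [IsIntegral C]

lemma genericPoint_mem [Nonempty U] : genericPoint C ∈ U :=
  ((genericPoint_spec C).mem_open_set_iff U.isOpen).mpr (by simpa using ‹Nonempty U›)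

/-- The stalk at the generic point is the field `F`. Nonzero primes of `F[X]` are maximal, so every
prime containing the nonzero polynomial is minimal over it. -/
lemma setOf_mem_minimalPoints_basePoint_eq_genericPoint [Nonempty U] (f : Γ(C, U)[X])
    (P : Γ(C, U)) (N : ℕ)
    (h0 : iterateSub (f.map (C.germToFunctionField U).hom) (C.germToFunctionField U P) N ≠ 0) :
    {x | x ∈ minimalPoints (locusSet U f P N : Set (line U)) ∧ basePoint U x = genericPoint C} =
      lineAt U (genericPoint C) (genericPoint_mem U) '' {p : PrimeSpectrum C.functionField[X] |
        iterateSub (f.map (C.germToFunctionField U).hom) (C.germToFunctionField U P) N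
          ∈ p.asIdeal} := by
  ext x
  constructor
  · rintro ⟨hx, hxη⟩
    have hr : x ∈ Set.range (lineAt U (genericPoint C) (genericPoint_mem U)) := by
      rw [range_lineAt]; exact specializes_of_eq hxη
    obtain ⟨y, rfl⟩ := hr
    rw [lineAt_mem_minimalPoints_iff] at hx
    exact ⟨y, hx.1.2 (Ideal.mem_span_singleton_self _), rfl⟩
  · rintro ⟨y, hy, rfl⟩
    refine ⟨?_, ?_⟩
    · rw [lineAt_mem_minimalPoints_iff]
      refine ⟨⟨y.2, (Ideal.span_singleton_le_iff_mem _).mpr hy⟩, fun q hq hqy => ?_⟩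
      have hq0 : q ≠ ⊥ := by
        rintro rfl
        exact h0 (by simpa using hq.2 (Ideal.mem_span_singleton_self _))
      have := hq.1
      have hmax : q.IsMaximal :=
        IsPrime.to_maximal_ideal (R := C.functionField[X]) hq0
      exact (hmax.eq_of_le y.2.ne_top hqy).ge
    · have h : lineAt U (genericPoint C) (genericPoint_mem U) y ∈
        Set.range (lineAt U (genericPoint C) (genericPoint_mem U)) := ⟨y, rfl⟩
      rw [range_lineAt] at h
      exact (h.antisymm (genericPoint_specializes _)).eq

lemma maximalIdeal_stalk_ne_bot {t : C} (ht : t ≠ genericPoint C) :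
    IsLocalRing.maximalIdeal (C.presheaf.stalk t) ≠ ⊥ := by
  intro h
  have hr : genericPoint C ∈ Set.range (C.fromSpecStalk t) := by
    rw [Scheme.range_fromSpecStalk]; exact genericPoint_specializes t
  obtain ⟨z, hz⟩ := hr
  -- If the maximal ideal were zero, the stalk would have only one prime, and `t` would be generic.
  have hzc : z = IsLocalRing.closedPoint (C.presheaf.stalk t) := by
    refine PrimeSpectrum.ext (le_antisymm (IsLocalRing.le_maximalIdeal z.2.ne_top) ?_)
    exact h.le.trans bot_le
  rw [hzc, Scheme.fromSpecStalk_closedPoint] at hz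
  exact ht hz

lemma mem_minimalPoints_iff_of_basePoint_ne [IsLocallyNoetherian C]
    (hdim : topologicalKrullDim C = 1) (f : Γ(C, U)[X]) (P : Γ(C, U)) {x : line U}
    (hx : basePoint U x ≠ genericPoint C) {N N' : ℕ} (hN : N ≠ 0) (hN' : N' ≠ 0)
    (h0 : iterateSub f P N ≠ 0) (h0' : iterateSub f P N' ≠ 0) :
    x ∈ minimalPoints (locusSet U f P N : Set (line U)) ↔
      x ∈ minimalPoints (locusSet U f P N' : Set (line U)) := by
  obtain ⟨t, htdef⟩ : ∃ t, t = basePoint U x := ⟨_, rfl⟩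
  have ht : t ∈ U := htdef ▸ basePoint_mem U x
  rw [← htdef] at hx
  have hr : x ∈ Set.range (lineAt U t ht) := by
    rw [range_lineAt]; exact specializes_of_eq htdef.symm
  obtain ⟨y, rfl⟩ := hr
  -- Localizing at the base point of `x` itself puts `y` over the closed point of the stalk.
  have hclosed : y.asIdeal.comap Polynomial.C = IsLocalRing.maximalIdeal (C.presheaf.stalk t) := by
    have h1 := (lineAt_base U t ht y).symm.trans
      (htdef.symm.trans (Scheme.fromSpecStalk_closedPoint (x := t)).symm)
    exact congrArg PrimeSpectrum.asIdeal ((C.fromSpecStalk t).injective h1)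
  have hne : ∀ n, iterateSub f P n ≠ 0 → iterateSub (f.map (C.presheaf.germ U t ht).hom)
      (C.presheaf.germ U t ht P) n ≠ 0 := by
    intro n hn h
    have h2 := map_iterateSub (C.presheaf.germ U t ht).hom f P n
    rw [show iterateSub _ _ n = 0 from h,
      Polynomial.map_eq_zero_iff (germ_injective_of_isIntegral C t ht)] at h2
    exact hn h2
  have := y.2
  rw [lineAt_mem_minimalPoints_iff, lineAt_mem_minimalPoints_iff]
  have hm := maximalIdeal_stalk_ne_bot hx
  have hht := height_maximalIdeal_stalk_le hdim t
  refine (mem_minimalPrimes_span_iff_of_comap_C_eq hm hht (hne N h0) hclosed).trans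
    (Iff.trans ?_ (mem_minimalPrimes_span_iff_of_comap_C_eq hm hht (hne N' h0') hclosed).symm)
  rw [iterateSub_mem_map_C_iff _ _ _ hN, iterateSub_mem_map_C_iff _ _ _ hN']

end LocusComponents

/-! ### Components of smooth projective models -/

section Models

variable {k : Type u} [Field k] {C : Scheme.{u}} (U : C.Opens)

lemma range_subschemeι_vanishingIdeal_locusSet (f : Γ(C, U)[X]) (P : Γ(C, U)) (N : ℕ) :
    Set.range (Scheme.IdealSheafData.vanishingIdeal (locusSet U f P N)).subschemeι =
      (locusSet U f P N : Set (line U)) := by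
  rw [Scheme.IdealSheafData.range_subschemeι, Scheme.IdealSheafData.coe_support_vanishingIdeal]

lemma isNoetherian_locus [IsNoetherian C] (f : Γ(C, U)[X]) (P : Γ(C, U)) (N : ℕ) :
    IsNoetherian (locus U f P N) := by
  have h1 : IsLocallyNoetherian (line U) :=
    LocallyOfFiniteType.isLocallyNoetherian (line U ↘ (U : Scheme.{u}))
  have hU : CompactSpace U := inferInstanceAs (CompactSpace (U : Set C))
  have h2 : CompactSpace (line U) :=
    QuasiCompact.compactSpace_of_compactSpace (line U ↘ (U : Scheme.{u}))
  let I := Scheme.IdealSheafData.vanishingIdeal (locusSet U f P N)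
  have h3 : IsLocallyNoetherian I.subscheme := LocallyOfFiniteType.isLocallyNoetherian I.subschemeι
  have h4 : CompactSpace I.subscheme := QuasiCompact.compactSpace_of_compactSpace I.subschemeι
  exact { h3, h4 with }

lemma encard_irreducibleComponents_locus (f : Γ(C, U)[X]) (P : Γ(C, U)) (N : ℕ) :
    (irreducibleComponents (locus U f P N)).encard =
      (minimalPoints (locusSet U f P N : Set (line U))).encard := by
  rw [← range_subschemeι_vanishingIdeal_locusSet]
  exact encard_irreducibleComponents_eq_encard_minimalPoints
    (Scheme.IdealSheafData.vanishingIdeal (locusSet U f P N)).subschemeι.isEmbedding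

/-- Birational noetherian schemes have equally many irreducible components. -/
lemma encard_irreducibleComponents_eq_of_partialIso {X Y : Scheme.{u}} [IsNoetherian X]
    [IsNoetherian Y] (e : Scheme.PartialIso X Y) :
    (irreducibleComponents X).encard = (irreducibleComponents Y).encard := by
  rw [← encard_irreducibleComponents_eq_of_isOpenEmbedding
      TopologicalSpace.NoetherianSpace.finite_irreducibleComponents e.source.ι.isOpenEmbedding
      (by rw [DenseRange, Scheme.Opens.range_ι]; exact e.dense_source),
    ← encard_irreducibleComponents_eq_of_isOpenEmbedding
      TopologicalSpace.NoetherianSpace.finite_irreducibleComponents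
      (e.iso.hom ≫ e.target.ι).isOpenEmbedding]
  have := e.dense_target
  rw [DenseRange, Scheme.Hom.comp_base, TopCat.coe_comp, Set.range_comp,
    e.iso.hom.surjective.range_eq, Set.image_univ, Scheme.Opens.range_ι]
  exact this

lemma encard_irreducibleComponents_of_isPreimageCurve [IsNoetherian C] (π : C ⟶ Spec (.of k))
    (f : Γ(C, U)[X]) (P : Γ(C, U)) (N : ℕ) {X : Scheme.{u}} {σ : X ⟶ Spec (.of k)}
    (h : IsPreimageCurve U π f P N σ) :
    (irreducibleComponents X).encard =
      (minimalPoints (locusSet U f P N : Set (line U))).encard := by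
  obtain ⟨hs, hp, e, -⟩ := h
  have h1 : IsLocallyNoetherian X := LocallyOfFiniteType.isLocallyNoetherian σ
  have h2 : CompactSpace X := QuasiCompact.compactSpace_of_compactSpace σ
  have h3 : IsNoetherian X := {}
  have h4 := isNoetherian_locus U f P N
  rw [encard_irreducibleComponents_eq_of_partialIso e, encard_irreducibleComponents_locus]

lemma IsCurve.isNoetherian {C : Scheme.{u}} [IsIntegral C] {π : C ⟶ Spec (.of k)}
    (h : IsCurve π) : IsNoetherian C := by
  have := h.locallyOfFiniteType
  have := h.quasiCompact
  have h1 : IsLocallyNoetherian C := LocallyOfFiniteType.isLocallyNoetherian π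
  have h2 : CompactSpace C := QuasiCompact.compactSpace_of_compactSpace π
  exact {}

end Models
end PreimageCurve

end

/-! ### Adding the horizontal and vertical counts -/

theorem corollary5 {k : Type u} [Field k] [IsAlgClosed k] [CharZero k]
    {C : Scheme.{u}} [IsIntegral C] (π : C ⟶ Spec (.of k)) (hC : PreimageCurve.IsCurve π)
    (f : C.functionField[X]) (P : C.functionField)
    (hfP : ∃ V : ValuationSubring C.functionField, PreimageCurve.IsPlace π V ∧
      PreimageCurve.HasGoodReduction V f ∧ P ∉ PreimageCurve.filledJuliaSet V f)
    (U : C.Opens) [Nonempty U] (fU : Γ(C, U)[X]) (PU : Γ(C, U))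
    (hfU : fU.map (C.germToFunctionField U).hom = f) (hPU : C.germToFunctionField U PU = P) :
    ∃ c N₀ : ℕ, ∀ N ≥ N₀, ∀ (X : Scheme.{u}) (σ : X ⟶ Spec (.of k)),
      PreimageCurve.IsPreimageCurve U π fU PU N σ → (irreducibleComponents X).encard = c := by
  open PreimageCurve in
  obtain ⟨V, hV, hf, hP⟩ := hfP
  have hdvr := hV.isDiscreteValuationRing
  have hnoeth := hC.isNoetherian
  have hd := (one_lt_valuation_of_notMem_filledJuliaSet hf hP).2
  have hne : ∀ N, iterateSub f P N ≠ 0 := fun N => by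
    refine ne_zero_of_natDegree_gt (n := 0) ?_
    rw [natDegree_iterateSub]
    exact pow_pos (Nat.pos_of_ne_zero hd) N
  have hneU : ∀ N, iterateSub fU PU N ≠ 0 := fun N h => by
    have h1 := map_iterateSub (C.germToFunctionField U).hom fU PU N
    rw [h, Polynomial.map_zero, hfU] at h1
    exact hne N (hPU ▸ h1.symm)
  obtain ⟨c, N₀, hc⟩ := exists_encard_primeSpectrum_eq hf hP
  -- Level `1` serves as reference for the vertical components of all levels `N ≥ 1`.
  let vert : Set (line U) :=
    {x | x ∈ minimalPoints (locusSet U fU PU 1 : Set (line U)) ∧ basePoint U x ≠ genericPoint C}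
  have hfin : vert.Finite := by
    refine Set.Finite.subset (Set.encard_ne_top_iff.mp ?_) fun x hx => hx.1
    rw [← encard_irreducibleComponents_locus, Set.encard_ne_top_iff]
    have := isNoetherian_locus U fU PU 1
    exact TopologicalSpace.NoetherianSpace.finite_irreducibleComponents
  -- Level `0` is excluded because `z - P` is monic in `z` and has no vertical components, whereas
  -- later levels may have some.
  refine ⟨c + vert.ncard, max N₀ 1, fun N hN X σ hX => ?_⟩
  have hN1 : N ≠ 0 := by have := le_of_max_le_right hN; omega
  have hor := setOf_mem_minimalPoints_basePoint_eq_genericPoint U fU PU N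
    (by rw [hfU, hPU]; exact hne N)
  rw [hfU, hPU] at hor
  have hsplit : minimalPoints (locusSet U fU PU N : Set (line U)) =
      {x | x ∈ minimalPoints (locusSet U fU PU N : Set (line U)) ∧
        basePoint U x = genericPoint C} ∪ vert := by
    ext x
    by_cases hx : basePoint U x = genericPoint C
    · simp [vert, hx]
    · simp [vert, hx, mem_minimalPoints_iff_of_basePoint_ne U hC.dim_eq_one fU PU hx hN1 one_ne_zero
        (hneU N) (hneU 1)]
  have hdisj : Disjoint {x | x ∈ minimalPoints (locusSet U fU PU N : Set (line U)) ∧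
      basePoint U x = genericPoint C} vert :=
    Set.disjoint_left.mpr fun x h1 h2 => h2.2 h1.2
  rw [encard_irreducibleComponents_of_isPreimageCurve U π fU PU N hX, hsplit,
    Set.encard_union_eq hdisj, hor, Nat.cast_add, hfin.cast_ncard_eq]
  congr 1
  exact ((lineAt U (genericPoint C) (genericPoint_mem U)).injective.encard_image _).trans
    (hc N (le_of_max_le_left hN))
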